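/- Let $S$ and $T$ be semigroups and let $S*T$ be their free product (the coproduct in the category of semigroups). For a semigroup $U$, a $U$-module is an abelian group $A$ with a map $U\times A\to A$, $(u,a)\mapsto ua$, such that $u(a+b)=ua+ub$ and $u(va)=(uv)a$ for all $u,v\in U$, $a,b\in A$. Let $C^n(U,A)$ be the group of all maps $U^n\to A$ and let $\partial^n\colon C^n(U,A)\to C^{n+1}(U,A)$ be given by $$\partial^n f(x_1,\dots,x_{n+1})=x_1f(x_2,\dots,x_{n+1})+\sum_{i=1}^n(-1)^i f(x_1,\dots,x_ix_{i+1},\dots,x_{n+1})+(-1)^{n+1}f(x_1,\dots,x_n),$$ and let $H^n(U,A)=\operatorname{Ker}\partial^n/\operatorname{Im}\partial^{n-1}$ be the $n$-th (Eilenberg–MacLane) cohomology group for $n\ge 1$. Then for every $n\ge 2$ and every $(S*T)$-module $A$ there is an isomorphism of abelian groups $$H^n(S*T,A)\cong H^n(S,A)\oplus H^n(T,A),$$ where $A$ is regarded as an $S$-module and as a $T$-module through the canonical homomorphisms $S\to S*T$ and $T\to S*T$. -/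

import Mathlib

namespace EMCohomology

/-- The defining relations of the free product of two semigroups, on words over the disjoint
union of `S` and `T`: a product of two letters of one factor is the letter of their product. -/
inductive FreeProductRel (S T : Type*) [Semigroup S] [Semigroup T] :
    FreeSemigroup (S ⊕ T) → FreeSemigroup (S ⊕ T) → Prop
  | inl (s s' : S) : FreeProductRel S T
      (FreeSemigroup.of (Sum.inl s) * FreeSemigroup.of (Sum.inl s'))
      (FreeSemigroup.of (Sum.inl (s * s')))
  | inr (t t' : T) : FreeProductRel S T
      (FreeSemigroup.of (Sum.inr t) * FreeSemigroup.of (Sum.inr t'))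
      (FreeSemigroup.of (Sum.inr (t * t')))

/-- The free product `S * T` of two semigroups (their coproduct in the category of semigroups):
the free semigroup on the disjoint union of `S` and `T`, modulo the congruence generated by the
multiplication tables of `S` and of `T`. No identity element is adjoined or identified. -/
abbrev FreeProduct (S T : Type*) [Semigroup S] [Semigroup T] : Type _ :=
  (conGen (FreeProductRel S T)).Quotient

/-- The canonical homomorphism `S → S * T`. -/
def FreeProduct.inl (S T : Type*) [Semigroup S] [Semigroup T] : S →ₙ* FreeProduct S T where
  toFun s := ((FreeSemigroup.of (Sum.inl s) : FreeSemigroup (S ⊕ T)) : FreeProduct S T)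
  map_mul' s s' :=
    ((Con.eq _).2 (ConGen.Rel.of _ _ (FreeProductRel.inl (T := T) s s'))).symm

/-- The canonical homomorphism `T → S * T`. -/
def FreeProduct.inr (S T : Type*) [Semigroup S] [Semigroup T] : T →ₙ* FreeProduct S T where
  toFun t := ((FreeSemigroup.of (Sum.inr t) : FreeSemigroup (S ⊕ T)) : FreeProduct S T)
  map_mul' t t' :=
    ((Con.eq _).2 (ConGen.Rel.of _ _ (FreeProductRel.inr (S := S) t t'))).symm

/-- A (left) `S`-module structure on the abelian group `A`: every `s : S` acts by an additive
endomorphism `a ↦ ρ s a`, and `ρ (s * t) a = ρ s (ρ t a)`. If `S` happens to have an identity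
element, it is not required to act as the identity. -/
abbrev ModuleStructure (S A : Type*) [Semigroup S] [AddCommGroup A] : Type _ :=
  S →ₙ* AddMonoid.End A

section Cohomology

variable {S A : Type*} [Semigroup S] [AddCommGroup A]

/-- The coboundary operator `∂ⁿ : Cⁿ(S, A) → Cⁿ⁺¹(S, A)`, where `Cⁿ(S, A)` is the group of all
`n`-place maps from `S` to `A`:
`∂ⁿ f (x₁, …, xₙ₊₁) = x₁ f (x₂, …, xₙ₊₁) + ∑ᵢ₌₁ⁿ (-1)ⁱ f (x₁, …, xᵢ xᵢ₊₁, …, xₙ₊₁)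
  + (-1)ⁿ⁺¹ f (x₁, …, xₙ)`.
Indices start at `0` in the code; `Fin.contractNth j (· * ·) x` replaces the two
neighbouring entries `x j`, `x (j + 1)` by their product. -/
def coboundary (ρ : ModuleStructure S A) (n : ℕ) :
    ((Fin n → S) → A) →+ ((Fin (n + 1) → S) → A) where
  toFun f x :=
    ρ (x 0) (f fun i => x i.succ)
      + ∑ j : Fin n, (-1 : ℤ) ^ ((j : ℕ) + 1) • f (Fin.contractNth j.castSucc (· * ·) x)
      + (-1 : ℤ) ^ (n + 1) • f fun i => x i.castSucc
  map_zero' := by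
    funext x
    simp
  map_add' f g := by
    funext x
    simp only [Pi.add_apply, map_add, smul_add, Finset.sum_add_distrib]
    abel

/-- The group `Zⁿ(S, A) = Ker ∂ⁿ` of `n`-dimensional cocycles. -/
def cocycles (ρ : ModuleStructure S A) (n : ℕ) : AddSubgroup ((Fin n → S) → A) :=
  (coboundary ρ n).ker

/-- The group `Bⁿ(S, A) = Im ∂ⁿ⁻¹` of `n`-dimensional coboundaries, with `B⁰(S, A) = 0`. -/
def coboundaries (ρ : ModuleStructure S A) : (n : ℕ) → AddSubgroup ((Fin n → S) → A)
  | 0 => ⊥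
  | n + 1 => (coboundary ρ n).range

/-- The Eilenberg–MacLane cohomology group `Hⁿ(S, A) = Zⁿ(S, A) / Bⁿ(S, A)`. -/
abbrev Cohomology (ρ : ModuleStructure S A) (n : ℕ) : Type _ :=
  cocycles ρ n ⧸ (coboundaries ρ n).addSubgroupOf (cocycles ρ n)

end Cohomology

end EMCohomology

/-! The proof is dimension shifting down to degree 1, followed by a Mayer–Vietoris argument. Write
`U = S * T`, let `U¹` be `U` with a new identity adjoined, and embed `A` in the coinduced module of
maps `U¹ → A` by `a ↦ (y ↦ y a)`. As `U¹` is free as a right set over `U¹`, `S¹` and `T¹`, the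
coinduced module has no cohomology in positive degrees over `U`, `S` or `T`. Its quotient by `A`,
`shiftModule ρ`, therefore lowers degree by one over all three semigroups.
`RightFree.nonempty_cohomology_shift` proves this by explicit cochain maps and a homotopy, without a
long exact sequence.

In degree 1, a derivation of `U` is a pair of derivations of `S` and `T`, so restriction is onto. It
is injective on classes when every element of the module is a sum of an `S`-invariant and a
`T`-invariant. Shifted modules have this property (`invariantsSpan_shiftModule`), and in degree `n ≥
2` at least one shift is available. -/

namespace EMCohomology

/-! ### Words in the free product and freeness over the factors -/

section Words

variable {S T : Type*} [Semigroup S] [Semigroup T]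

/-- Induction on words by right multiplication with letters, starting from the empty word. -/
theorem FreeProduct.withOne_induction {P : WithOne (FreeProduct S T) → Prop} (one : P 1)
    (inl : ∀ y s, P y → P (y * (FreeProduct.inl S T s : FreeProduct S T)))
    (inr : ∀ y t, P y → P (y * (FreeProduct.inr S T t : FreeProduct S T)))
    (y : WithOne (FreeProduct S T)) : P y := by
  have letter : ∀ (x : S ⊕ T) (y : WithOne (FreeProduct S T)), P y →
      P (y * ((FreeSemigroup.of x : FreeSemigroup (S ⊕ T)) : FreeProduct S T)) := by
    rintro (s | t) y hy
    · exact inl y s hy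
    · exact inr y t hy
  have key : ∀ (w : FreeSemigroup (S ⊕ T)) (y : WithOne (FreeProduct S T)), P y →
      P (y * (w : FreeProduct S T)) := by
    intro w
    induction w using FreeSemigroup.recOnMul with
    | ih1 x => exact letter x
    | ih2 x w _ hw =>
      intro y hy
      have := hw _ (letter x y hy)
      rwa [mul_assoc, ← WithOne.coe_mul, ← Con.coe_mul] at this
  refine WithOne.cases_on y one fun u => ?_
  induction u using Con.induction_on with
  | _ w => simpa using key w 1 one

/-- Right actions of `S` and of `T` on `X` extend to a right action of `(S * T)¹`; this is the orbit
map of a point. -/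
theorem FreeProduct.exists_orbitMap {X : Type*} (x₀ : X) (actS : X → S → X) (actT : X → T → X)
    (hS : ∀ x s s', actS x (s * s') = actS (actS x s) s')
    (hT : ∀ x t t', actT x (t * t') = actT (actT x t) t') :
    ∃ e : WithOne (FreeProduct S T) → X, e 1 = x₀ ∧
      (∀ y s, e (y * (FreeProduct.inl S T s : FreeProduct S T)) = actS (e y) s) ∧
      (∀ y t, e (y * (FreeProduct.inr S T t : FreeProduct S T)) = actT (e y) t) := by
  -- The opposite monoid turns right actions into homomorphisms.
  let F : FreeSemigroup (S ⊕ T) →ₙ* (Function.End X)ᵐᵒᵖ :=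
    FreeSemigroup.lift (Sum.elim (fun s => MulOpposite.op fun x => actS x s)
      (fun t => MulOpposite.op fun x => actT x t))
  have hle : conGen (FreeProductRel S T) ≤ Con.ker F := by
    refine Con.conGen_le.2 ?_
    rintro _ _ (⟨s, s'⟩ | ⟨t, t'⟩)
    · refine (Con.ker_rel F).2 ?_
      rw [map_mul]
      refine MulOpposite.unop_injective (funext fun x => ?_)
      exact (hS x s s').symm
    · refine (Con.ker_rel F).2 ?_
      rw [map_mul]
      refine MulOpposite.unop_injective (funext fun x => ?_)
      exact (hT x t t').symm
  let act : FreeProduct S T → X → X := fun u =>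
    Con.liftOn u (fun w => (F w).unop) fun a b hab => congrArg MulOpposite.unop (hle hab)
  have act_mul : ∀ u v x, act (u * v) x = act v (act u x) := by
    intro u v x
    induction u using Con.induction_on with
    | _ w =>
      induction v using Con.induction_on with
      | _ w' =>
        change (F (w * w')).unop x = (F w').unop ((F w).unop x)
        rw [map_mul]
        rfl
  refine ⟨fun y => WithOne.recOneCoe x₀ (fun u => act u x₀) y, rfl, fun y s => ?_, fun y t => ?_⟩
  · exact WithOne.cases_on y rfl fun u => act_mul _ _ _
  · exact WithOne.cases_on y rfl fun u => act_mul _ _ _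

/-- A function on `(S * T)¹` may be prescribed by its increments along right multiplication
by `S` and by `T`. -/
theorem FreeProduct.exists_of_increments {M : Type*} [AddCommGroup M]
    (kS : WithOne (FreeProduct S T) → S → M) (kT : WithOne (FreeProduct S T) → T → M)
    (hS : ∀ y s s', kS y (s * s') = kS y s + kS (y * (FreeProduct.inl S T s : FreeProduct S T)) s')
    (hT : ∀ y t t', kT y (t * t') = kT y t + kT (y * (FreeProduct.inr S T t : FreeProduct S T)) t') :
    ∃ d : WithOne (FreeProduct S T) → M, d 1 = 0 ∧
      (∀ y s, d (y * (FreeProduct.inl S T s : FreeProduct S T)) = d y + kS y s) ∧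
      (∀ y t, d (y * (FreeProduct.inr S T t : FreeProduct S T)) = d y + kT y t) := by
  -- Carrying the current position beside the running value makes the increments a right action;
  -- `hS` and `hT` are the action laws in the value coordinate.
  obtain ⟨e, e1, eS, eT⟩ := FreeProduct.exists_orbitMap (S := S) (T := T)
    (X := M × WithOne (FreeProduct S T)) (0, 1)
    (fun x s => (x.1 + kS x.2 s, x.2 * (FreeProduct.inl S T s : FreeProduct S T)))
    (fun x t => (x.1 + kT x.2 t, x.2 * (FreeProduct.inr S T t : FreeProduct S T)))
    (fun x s s' => by
      simp only [hS, map_mul, WithOne.coe_mul, mul_assoc, add_assoc])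
    (fun x t t' => by
      simp only [hT, map_mul, WithOne.coe_mul, mul_assoc, add_assoc])
  have hsnd : ∀ y, (e y).2 = y := by
    intro y
    induction y using FreeProduct.withOne_induction with
    | one => rw [e1]
    | inl y s hy => rw [eS, hy]
    | inr y t hy => rw [eT, hy]
  refine ⟨fun y => (e y).1, by simp [e1], fun y s => ?_, fun y t => ?_⟩
  · simp only [eS, hsnd]
  · simp only [eT, hsnd]

/-- A decomposition `y = base y * part y` showing that `U¹` is free as a right `S¹`-set. -/
structure RightFree {S U : Type*} [Semigroup S] [Semigroup U] (ι : S →ₙ* U) where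
  /-- The chosen representative of the `S¹`-orbit. -/
  base : WithOne U → WithOne U
  /-- The position in the `S¹`-orbit. -/
  part : WithOne U → WithOne S
  base_one : base 1 = 1
  part_one : part 1 = 1
  base_mul (y : WithOne U) (s : S) : base (y * (ι s : U)) = base y
  part_mul (y : WithOne U) (s : S) : part (y * (ι s : U)) = part y * s
  base_mul_part (y : WithOne U) : base y * WithOne.mapMulHom ι (part y) = y

/-- A semigroup with identity adjoined is free over itself. -/
def RightFree.id (S : Type*) [Semigroup S] : RightFree (MulHom.id S) where
  base _ := 1
  part y := y
  base_one := rfl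
  part_one := rfl
  base_mul _ _ := rfl
  part_mul _ _ := rfl
  base_mul_part y := by simp

/-- A word is read from the left while its trailing `S`-block is stored separately: a letter of `S`
extends the block, a letter of `T` flushes it into the base. This is an orbit map, so no normal form
theorem is needed. -/
theorem FreeProduct.nonempty_rightFree_inl : Nonempty (RightFree (FreeProduct.inl S T)) := by
  obtain ⟨e, e1, eS, eT⟩ := FreeProduct.exists_orbitMap (S := S) (T := T)
    (X := WithOne (FreeProduct S T) × WithOne S) (1, 1)
    (fun x s => (x.1, x.2 * s))
    (fun x t => (x.1 * WithOne.mapMulHom (FreeProduct.inl S T) x.2 *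
      (FreeProduct.inr S T t : FreeProduct S T), 1))
    (fun x s s' => by simp [mul_assoc])
    (fun x t t' => by simp [mul_assoc])
  refine ⟨⟨fun y => (e y).1, fun y => (e y).2, by simp [e1], by simp [e1],
    fun y s => by rw [eS], fun y s => by rw [eS], fun y => ?_⟩⟩
  induction y using FreeProduct.withOne_induction with
  | one => simp [e1]
  | inl y s hy => rw [eS, map_mul, ← mul_assoc, hy]; rfl
  | inr y t hy => rw [eT, hy, map_one, mul_one]

theorem FreeProduct.nonempty_rightFree_inr : Nonempty (RightFree (FreeProduct.inr S T)) := by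
  obtain ⟨e, e1, eS, eT⟩ := FreeProduct.exists_orbitMap (S := S) (T := T)
    (X := WithOne (FreeProduct S T) × WithOne T) (1, 1)
    (fun x s => (x.1 * WithOne.mapMulHom (FreeProduct.inr S T) x.2 *
      (FreeProduct.inl S T s : FreeProduct S T), 1))
    (fun x t => (x.1, x.2 * t))
    (fun x s s' => by simp [mul_assoc])
    (fun x t t' => by simp [mul_assoc])
  refine ⟨⟨fun y => (e y).1, fun y => (e y).2, by simp [e1], by simp [e1],
    fun y s => by rw [eT], fun y s => by rw [eT], fun y => ?_⟩⟩
  induction y using FreeProduct.withOne_induction with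
  | one => simp [e1]
  | inl y s hy => rw [eS, hy, map_one, mul_one]
  | inr y t hy => rw [eT, map_mul, ← mul_assoc, hy]; rfl

end Words

section Quotients

theorem nonempty_quotient_addEquiv {Z G : Type*} [AddCommGroup Z] [AddCommGroup G]
    (N : AddSubgroup Z) (f : Z →+ G) (hker : ∀ z, f z = 0 ↔ z ∈ N) (hf : Function.Surjective f) :
    Nonempty (Z ⧸ N ≃+ G) := by
  have h : N = f.ker := by
    ext z
    exact (hker z).symm
  subst h
  exact ⟨QuotientAddGroup.quotientKerEquivOfSurjective f hf⟩

end Quotients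

theorem eq_one_or_exists_coe {X : Type*} (y : WithOne X) : y = 1 ∨ ∃ s : X, y = s :=
  WithOne.cases_on y (Or.inl rfl) fun s => Or.inr ⟨s, rfl⟩

/-! ### The coboundary on a tuple with a prepended entry -/

section Bar

variable {S A : Type*} [Semigroup S] [AddCommGroup A]

/-- All terms of the coboundary but the first. -/
def faceSum (n : ℕ) (f : (Fin n → S) → A) (x : Fin (n + 1) → S) : A :=
  ∑ j : Fin n, (-1 : ℤ) ^ ((j : ℕ) + 1) • f (Fin.contractNth j.castSucc (· * ·) x)
    + (-1 : ℤ) ^ (n + 1) • f fun i => x i.castSucc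

theorem coboundary_apply (ρ : ModuleStructure S A) (n : ℕ) (f : (Fin n → S) → A)
    (x : Fin (n + 1) → S) :
    coboundary ρ n f x = ρ (x 0) (f (Fin.tail x)) + faceSum n f x :=
  add_assoc _ _ _

theorem faceSum_map {B Φ : Type*} [AddCommGroup B] [FunLike Φ A B] [AddMonoidHomClass Φ A B]
    (φ : Φ) (n : ℕ) (f : (Fin n → S) → A)
    (x : Fin (n + 1) → S) : faceSum n (fun z => φ (f z)) x = φ (faceSum n f x) := by
  simp [faceSum]

theorem faceSum_apply {Y : Type*} (n : ℕ) (f : (Fin n → S) → Y → A)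
    (x : Fin (n + 1) → S) (y : Y) : faceSum n f x y = faceSum n (fun z => f z y) x :=
  (faceSum_map (Pi.evalAddMonoidHom (fun _ : Y => A) y) n f x).symm

theorem contractNth_zero_cons (n : ℕ) (y : S) (x : Fin (n + 1) → S) :
    Fin.contractNth (0 : Fin (n + 2)) (· * ·) (Fin.cons y x : Fin (n + 2) → S) =
      Fin.cons (y * x 0) (Fin.tail x) := by
  funext k
  refine Fin.cases ?_ (fun k => ?_) k
  · rw [Fin.contractNth_apply_of_eq _ _ _ _ (by simp)]
    simp
  · rw [Fin.contractNth_apply_of_gt _ _ _ _ (by simp)]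
    simp [Fin.tail]

theorem contractNth_succ_cons (n : ℕ) (y : S) (x : Fin (n + 1) → S) (j : Fin (n + 1)) :
    Fin.contractNth j.succ (· * ·) (Fin.cons y x : Fin (n + 2) → S) =
      Fin.cons y (Fin.contractNth j (· * ·) x) := by
  funext k
  refine Fin.cases ?_ (fun k => ?_) k
  · rw [Fin.contractNth_apply_of_lt _ _ _ _ (by simp)]
    simp
  · simp only [Fin.contractNth, Fin.cons_succ, Fin.val_succ, add_lt_add_iff_right,
      add_left_inj, Fin.castSucc_succ]

/-- Only the first contraction involves `y`; the other faces are those of `x`, with index raised by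
one and hence sign reversed. -/
theorem faceSum_cons (n : ℕ) (f : (Fin (n + 1) → S) → A) (y : S) (x : Fin (n + 1) → S) :
    faceSum (n + 1) f (Fin.cons y x) =
      -f (Fin.cons (y * x 0) (Fin.tail x)) - faceSum n (fun z => f (Fin.cons y z)) x := by
  have hlast : (fun i : Fin (n + 1) => (Fin.cons y x : Fin (n + 2) → S) i.castSucc) =
      Fin.cons y fun i : Fin n => x i.castSucc := by
    funext k
    refine Fin.cases ?_ (fun k => ?_) k
    · simp
    · simp
  simp only [faceSum, Fin.sum_univ_succ, hlast]
  simp only [Fin.castSucc_zero, contractNth_zero_cons, ← Fin.succ_castSucc, contractNth_succ_cons,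
    Fin.val_zero, Fin.val_succ, pow_succ (-1 : ℤ) (_ + 1), mul_neg, mul_one, neg_smul,
    Finset.sum_neg_distrib]
  simp
  abel

theorem coboundary_cons (ρ : ModuleStructure S A) (n : ℕ) (f : (Fin (n + 1) → S) → A) (y : S)
    (x : Fin (n + 1) → S) :
    coboundary ρ (n + 1) f (Fin.cons y x) =
      ρ y (f x) - f (Fin.cons (y * x 0) (Fin.tail x)) -
        faceSum n (fun z => f (Fin.cons y z)) x := by
  rw [coboundary_apply, faceSum_cons, Fin.cons_zero, Fin.tail_cons]
  abel

end Bar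

/-! ### The coinduced module and dimension shifting -/

section Coinduced

variable {U A : Type*} [AddCommGroup A]

/-- Evaluation of a map on `U`, extended by `0` to `U¹`. -/
def evalOne (y : WithOne U) : (U → A) →+ A :=
  WithOne.recOneCoe 0 (fun u => Pi.evalAddMonoidHom (fun _ : U => A) u) y

@[simp] theorem evalOne_one (h : U → A) : evalOne 1 h = 0 := rfl

@[simp] theorem evalOne_coe (u : U) (h : U → A) : evalOne (u : WithOne U) h = h u := rfl

variable [Semigroup U]

/-- The action of `U¹` on a `U`-module. -/
abbrev ModuleStructure.withOne (ρ : ModuleStructure U A) : WithOne U →* AddMonoid.End A :=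
  WithOne.lift ρ

/-- The cokernel of the canonical embedding of `A` into the coinduced module of maps `U¹ → A`,
realised on the maps `U → A`. -/
def shiftModule (ρ : ModuleStructure U A) : ModuleStructure U (U → A) where
  toFun u :=
    { toFun := fun h y => h (y * u) - ρ y (h u)
      map_zero' := by
        funext y
        simp
      map_add' := fun h h' => by
        funext y
        simp only [Pi.add_apply, map_add]
        abel }
  map_mul' u v := by
    ext h y
    change h (y * (u * v)) - ρ y (h (u * v)) =
      h (y * u * v) - ρ (y * u) (h v) - ρ y (h (u * v) - ρ u (h v))
    simp only [map_sub, map_mul, mul_assoc,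
      AddMonoid.End.coe_mul, Function.comp_apply]
    abel

theorem shiftModule_apply (ρ : ModuleStructure U A) (u : U) (h : U → A) (y : U) :
    shiftModule ρ u h y = h (y * u) - ρ y (h u) := rfl

theorem evalOne_shiftModule (ρ : ModuleStructure U A) (u : U) (h : U → A) (y : WithOne U) :
    evalOne y (shiftModule ρ u h) =
      evalOne (y * (u : WithOne U)) h - ρ.withOne y (h u) := by
  refine WithOne.cases_on y (by simp) fun v => ?_
  rw [← WithOne.coe_mul, evalOne_coe, evalOne_coe, shiftModule_apply, WithOne.lift_coe]

variable {S : Type*} [Semigroup S] (ρ : ModuleStructure U A) (ι : S →ₙ* U)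

/-- Dimension shifting on cochains. -/
def shiftUp (n : ℕ) : ((Fin n → S) → U → A) →+ ((Fin (n + 1) → S) → A) where
  toFun F x := F (Fin.tail x) (ι (x 0))
  map_zero' := rfl
  map_add' _ _ := rfl

theorem shiftUp_cons (n : ℕ) (F : (Fin n → S) → U → A) (s : S) (x : Fin n → S) :
    shiftUp ι n F (Fin.cons s x) = F x (ι s) := rfl

/-- The correction term in `shiftModule` is exactly the leading term of the coboundary over `A`, so
`shiftUp` commutes with coboundaries up to sign. -/
theorem coboundary_shiftUp (n : ℕ) (F : (Fin n → S) → U → A) :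
    coboundary (ρ.comp ι) (n + 1) (shiftUp ι n F) =
      -shiftUp ι (n + 1) (coboundary ((shiftModule ρ).comp ι) n F) := by
  funext x
  rw [← Fin.cons_self_tail x]
  generalize x 0 = y
  generalize Fin.tail x = x
  rw [coboundary_cons, Pi.neg_apply, shiftUp_cons, shiftUp_cons, coboundary_apply, Pi.add_apply,
    faceSum_apply, MulHom.comp_apply, MulHom.comp_apply, shiftModule_apply]
  simp only [shiftUp_cons]
  simp only [shiftUp, AddMonoidHom.coe_mk, ZeroHom.coe_mk, map_mul]
  abel

variable {ι} (D : RightFree ι)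

/-- The coinduction of a map `S → A` along a basis of `U¹` over `S¹`, evaluated at a point. -/
def RightFree.coind (y : WithOne U) : (S → A) →+ A :=
  WithOne.recOneCoe 0
    (fun s => (ρ.withOne (D.base y)).comp (Pi.evalAddMonoidHom (fun _ : S => A) s)) (D.part y)

theorem RightFree.coind_of_part_eq_one {y : WithOne U} (h : D.part y = 1) (c : S → A) :
    D.coind ρ y c = 0 := by
  simp [RightFree.coind, h]

theorem RightFree.coind_of_part_eq_coe {y : WithOne U} {s : S} (h : D.part y = s) (c : S → A) :
    D.coind ρ y c = ρ.withOne (D.base y) (c s) := by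
  simp only [RightFree.coind, h, WithOne.recOneCoe_coe]
  rfl

theorem RightFree.base_coe (s : S) : D.base (ι s : U) = 1 := by
  rw [← one_mul ((ι s : U) : WithOne U), D.base_mul, D.base_one]

theorem RightFree.part_coe (s : S) : D.part (ι s : U) = s := by
  rw [← one_mul ((ι s : U) : WithOne U), D.part_mul, D.part_one, one_mul]

theorem RightFree.base_eq_self {y : WithOne U} (h : D.part y = 1) : D.base y = y := by
  simpa [h] using D.base_mul_part y

theorem RightFree.base_mul_coe {y : WithOne U} {s : S} (h : D.part y = s) :
    D.base y * (ι s : U) = y := by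
  simpa [h] using D.base_mul_part y

theorem RightFree.coind_coe (s : S) (c : S → A) : D.coind ρ (ι s : U) c = c s := by
  rw [D.coind_of_part_eq_coe ρ (D.part_coe s), D.base_coe, map_one]
  rfl

/-- The section of `shiftUp` given by coinduction. -/
def RightFree.shiftDown (n : ℕ) : ((Fin (n + 1) → S) → A) →+ ((Fin n → S) → U → A) where
  toFun f x u := D.coind ρ u fun s => f (Fin.cons s x)
  map_zero' := by
    funext x u
    exact map_zero _
  map_add' f g := by
    funext x u
    exact map_add (D.coind ρ u) (fun s => f (Fin.cons s x)) fun s => g (Fin.cons s x)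

theorem RightFree.shiftDown_apply (n : ℕ) (f : (Fin (n + 1) → S) → A) (x : Fin n → S) (u : U) :
    D.shiftDown ρ n f x u = D.coind ρ u fun s => f (Fin.cons s x) := rfl

theorem RightFree.shiftUp_shiftDown (n : ℕ) (f : (Fin (n + 1) → S) → A) :
    shiftUp ι n (D.shiftDown ρ n f) = f := by
  funext x
  rw [← Fin.cons_self_tail x, shiftUp_cons, shiftDown_apply, coind_coe]

/-- At a point with trivial `S`-part only the two terms of the shifted action survive, and they
cancel. At `base * s` the identity is `coboundary_cons` with first entry `s`, acted on by `base`. -/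
theorem RightFree.coboundary_shiftDown (n : ℕ) (f : (Fin (n + 1) → S) → A) :
    coboundary ((shiftModule ρ).comp ι) n (D.shiftDown ρ n f) =
      -D.shiftDown ρ (n + 1) (coboundary (ρ.comp ι) (n + 1) f) := by
  funext x u
  rw [coboundary_apply, Pi.add_apply, faceSum_apply, MulHom.comp_apply, shiftModule_apply,
    Pi.neg_apply, Pi.neg_apply]
  simp only [shiftDown_apply, coind_coe, WithOne.coe_mul]
  rcases eq_one_or_exists_coe (D.part (u : WithOne U)) with h | ⟨s, h⟩
  · have h' : D.part ((u : WithOne U) * (ι (x 0) : U)) = (x 0 : S) := by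
      rw [D.part_mul, h, one_mul]
    simp only [D.coind_of_part_eq_one ρ h, D.coind_of_part_eq_coe ρ h', D.base_mul,
      D.base_eq_self h, WithOne.lift_coe]
    simp [faceSum]
  · have h' : D.part ((u : WithOne U) * (ι (x 0) : U)) = (s * x 0 : S) := by
      rw [D.part_mul, h, WithOne.coe_mul]
    have hρ : ∀ a, ρ u a = ρ.withOne (D.base u) (ρ (ι s) a) := by
      intro a
      have := congrArg (fun y => ρ.withOne y a) (D.base_mul_coe h)
      simp only [map_mul, WithOne.lift_coe] at this
      exact this.symm
    simp only [D.coind_of_part_eq_coe ρ h, D.coind_of_part_eq_coe ρ h', D.base_mul, hρ,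
      coboundary_cons, faceSum_map (ρ.withOne (D.base u)) n fun z => f (Fin.cons s z),
      Fin.cons_self_tail, MulHom.comp_apply, map_sub]
    abel

/-- The homotopy between the identity and `shiftDown ∘ shiftUp`. -/
def RightFree.homotopy (n : ℕ) (F : (Fin (n + 1) → S) → U → A) (x : Fin n → S) (u : U) : A :=
  WithOne.recOneCoe (0 : A) (fun s => evalOne (D.base u) (F (Fin.cons s x))) (D.part u)

theorem RightFree.homotopy_of_part_eq_one (n : ℕ) (F : (Fin (n + 1) → S) → U → A) (x : Fin n → S)
    {u : U} (h : D.part u = 1) : D.homotopy n F x u = 0 := by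
  simp [RightFree.homotopy, h]

theorem RightFree.homotopy_of_part_eq_coe (n : ℕ) (F : (Fin (n + 1) → S) → U → A)
    (x : Fin n → S) {u : U} {s : S} (h : D.part u = s) :
    D.homotopy n F x u = evalOne (D.base u) (F (Fin.cons s x)) := by
  simp [RightFree.homotopy, h]

theorem RightFree.eq_shiftDown_shiftUp_add (n : ℕ) (F : (Fin (n + 1) → S) → U → A)
    (hF : coboundary ((shiftModule ρ).comp ι) (n + 1) F = 0) :
    F = D.shiftDown ρ (n + 1) (shiftUp ι (n + 1) F) +
      coboundary ((shiftModule ρ).comp ι) n (D.homotopy n F) := by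
  funext x u
  rw [Pi.add_apply, Pi.add_apply, coboundary_apply, Pi.add_apply, faceSum_apply,
    MulHom.comp_apply, shiftModule_apply, shiftDown_apply,
    D.homotopy_of_part_eq_coe n F _ (D.part_coe (x 0)), D.base_coe, evalOne_one, map_zero, sub_zero]
  simp only [shiftUp_cons]
  rcases eq_one_or_exists_coe (D.part (u : WithOne U)) with h | ⟨s, h⟩
  · have h' : D.part ((u * ι (x 0) : U) : WithOne U) = (x 0 : S) := by
      rw [WithOne.coe_mul, D.part_mul, h, one_mul]
    rw [D.coind_of_part_eq_one ρ h, D.homotopy_of_part_eq_coe n F _ h', WithOne.coe_mul,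
      D.base_mul, D.base_eq_self h, Fin.cons_self_tail, evalOne_coe]
    simp [D.homotopy_of_part_eq_one n F _ h, faceSum]
  · have h' : D.part ((u * ι (x 0) : U) : WithOne U) = (s * x 0 : S) := by
      rw [WithOne.coe_mul, D.part_mul, h, WithOne.coe_mul]
    -- With `u = base * s`, the cocycle identity at `(s, x)` evaluated at the base is the required
    -- equation.
    have hc := congrArg (evalOne (D.base u)) (congrFun hF (Fin.cons s x))
    rw [coboundary_cons, MulHom.comp_apply, map_sub, map_sub, evalOne_shiftModule,
      D.base_mul_coe h, evalOne_coe, Pi.zero_apply, map_zero] at hc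
    rw [D.coind_of_part_eq_coe ρ h, D.homotopy_of_part_eq_coe n F _ h', WithOne.coe_mul,
      D.base_mul]
    simp only [D.homotopy_of_part_eq_coe n F _ h,
      faceSum_map (evalOne (D.base u)) n fun z => F (Fin.cons s z)]
    rw [← sub_eq_zero, ← hc]
    abel

/-- Dimension shifting. -/
theorem RightFree.nonempty_cohomology_shift (D : RightFree ι) (n : ℕ) :
    Nonempty (Cohomology ((shiftModule ρ).comp ι) (n + 1) ≃+
      Cohomology (ρ.comp ι) (n + 2)) := by
  have hmem : ∀ F ∈ cocycles ((shiftModule ρ).comp ι) (n + 1),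
      shiftUp ι (n + 1) F ∈ cocycles (ρ.comp ι) (n + 2) := by
    intro F hF
    have hF' : coboundary ((shiftModule ρ).comp ι) (n + 1) F = 0 := hF
    change coboundary _ _ _ = 0
    rw [coboundary_shiftUp, hF', map_zero, neg_zero]
  refine nonempty_quotient_addEquiv _
    ((QuotientAddGroup.mk' ((coboundaries (ρ.comp ι) (n + 2)).addSubgroupOf
      (cocycles (ρ.comp ι) (n + 2)))).comp
      (((shiftUp ι (n + 1)).comp (AddSubgroup.subtype _)).codRestrict
        (cocycles (ρ.comp ι) (n + 2)) fun F => hmem F F.2)) ?_ ?_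
  · rintro ⟨F, hF⟩
    refine (QuotientAddGroup.eq_zero_iff _).trans ?_
    change shiftUp ι (n + 1) F ∈ (coboundary (ρ.comp ι) (n + 1)).range ↔
      F ∈ (coboundary ((shiftModule ρ).comp ι) n).range
    constructor
    · rintro ⟨g, hg⟩
      -- `shiftDown` anticommutes with coboundaries, hence the minus sign; the homotopy accounts for
      -- `F` minus its image under `shiftDown ∘ shiftUp`.
      refine ⟨-D.shiftDown ρ n g + D.homotopy n F, ?_⟩
      rw [map_add, map_neg, D.coboundary_shiftDown, neg_neg, hg]
      exact (D.eq_shiftDown_shiftUp_add ρ n F hF).symm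
    · rintro ⟨G, rfl⟩
      refine ⟨-shiftUp ι n G, ?_⟩
      rw [map_neg, coboundary_shiftUp, neg_neg]
  · intro q
    obtain ⟨⟨f, hf⟩, rfl⟩ := QuotientAddGroup.mk_surjective q
    have hf' : coboundary (ρ.comp ι) (n + 2) f = 0 := hf
    refine ⟨⟨D.shiftDown ρ (n + 1) f, ?_⟩, ?_⟩
    · change coboundary _ _ _ = 0
      rw [D.coboundary_shiftDown, hf', map_zero, neg_zero]
    · exact congrArg (QuotientAddGroup.mk' _) (Subtype.ext (D.shiftUp_shiftDown ρ (n + 1) f))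

end Coinduced

/-! ### Degree one: derivations, invariants and the induction on degree -/

section FirstCohomology

variable {S T M : Type*} [Semigroup S] [Semigroup T] [AddCommGroup M]

theorem fin_one_eq {X : Type*} (x : Fin 1 → X) : x = ![x 0] := by
  funext i
  rw [Subsingleton.elim i 0]
  rfl

theorem coboundary_one_apply (ρ : ModuleStructure S M) (f : (Fin 1 → S) → M) (s t : S) :
    coboundary ρ 1 f ![s, t] = ρ s (f ![t]) - f ![s * t] + f ![s] := by
  have hc := coboundary_cons ρ 0 f s ![t]
  have e : (Fin.cons (s * t) (Fin.tail ![t]) : Fin 1 → S) = ![s * t] := fin_one_eq _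
  have e' : (Fin.cons s fun i : Fin 0 => ![t] i.castSucc : Fin 1 → S) = ![s] := fin_one_eq _
  change coboundary ρ 1 f (Fin.cons s ![t]) = _
  rw [hc]
  simp only [Matrix.cons_val_zero, e, faceSum, e', Finset.univ_eq_empty, Finset.sum_empty]
  simp

theorem mem_cocycles_one (ρ : ModuleStructure S M) (f : (Fin 1 → S) → M) :
    f ∈ cocycles ρ 1 ↔ ∀ s t, f ![s * t] = f ![s] + ρ s (f ![t]) := by
  constructor
  · intro hf s t
    have h : coboundary ρ 1 f = 0 := hf
    have := congrFun h ![s, t]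
    rw [coboundary_one_apply, Pi.zero_apply] at this
    rw [← sub_eq_zero, ← neg_eq_zero, ← this]
    abel
  · intro h
    change coboundary ρ 1 f = 0
    funext x
    have e : x = ![x 0, x 1] := by
      funext i
      fin_cases i <;> rfl
    rw [e, coboundary_one_apply, h, Pi.zero_apply]
    abel

theorem mem_coboundaries_one (ρ : ModuleStructure S M) (f : (Fin 1 → S) → M) :
    f ∈ coboundaries ρ 1 ↔ ∃ m, ∀ s, f ![s] = ρ s m - m := by
  have key : ∀ (g : (Fin 0 → S) → M) (x : Fin 1 → S),
      coboundary ρ 0 g x = ρ (x 0) (g ![]) - g ![] := by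
    intro g x
    rw [coboundary_apply]
    simp [faceSum, Subsingleton.elim _ (![] : Fin 0 → S), sub_eq_add_neg]
  constructor
  · rintro ⟨g, rfl⟩
    exact ⟨g ![], fun s => key g ![s]⟩
  · rintro ⟨m, hm⟩
    refine ⟨fun _ => m, ?_⟩
    funext x
    rw [key, fin_one_eq x, hm]
    rfl

/-- Restriction of one-dimensional cocycles. -/
def restrictCocycles {U : Type*} [Semigroup U] (ρ : ModuleStructure U M) (ι : S →ₙ* U) :
    cocycles ρ 1 →+ cocycles (ρ.comp ι) 1 where
  toFun f := ⟨fun x => f.1 ![ι (x 0)], by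
    rw [mem_cocycles_one]
    intro s t
    have := (mem_cocycles_one ρ f.1).1 f.2 (ι s) (ι t)
    rwa [← map_mul] at this⟩
  map_zero' := rfl
  map_add' _ _ := rfl

theorem restrictCocycles_apply {U : Type*} [Semigroup U] (ρ : ModuleStructure U M) (ι : S →ₙ* U)
    (f : cocycles ρ 1) (s : S) : (restrictCocycles ρ ι f).1 ![s] = f.1 ![ι s] := rfl

theorem FreeProduct.induction {P : FreeProduct S T → Prop}
    (inl : ∀ s, P (FreeProduct.inl S T s)) (inr : ∀ t, P (FreeProduct.inr S T t))
    (mul_inl : ∀ u s, P u → P (u * FreeProduct.inl S T s))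
    (mul_inr : ∀ u t, P u → P (u * FreeProduct.inr S T t)) (u : FreeProduct S T) : P u := by
  have key : ∀ y : WithOne (FreeProduct S T), ∀ u : FreeProduct S T, y = u → P u := by
    intro y
    induction y using FreeProduct.withOne_induction with
    | one =>
      intro u hu
      exact absurd hu WithOne.one_ne_coe
    | inl y s hy =>
      rcases eq_one_or_exists_coe y with rfl | ⟨v, rfl⟩
      · intro u hu
        rw [one_mul, WithOne.coe_inj] at hu
        exact hu ▸ inl s
      · intro u hu
        rw [← WithOne.coe_mul, WithOne.coe_inj] at hu
        exact hu ▸ mul_inl v s (hy v rfl)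
    | inr y t hy =>
      rcases eq_one_or_exists_coe y with rfl | ⟨v, rfl⟩
      · intro u hu
        rw [one_mul, WithOne.coe_inj] at hu
        exact hu ▸ inr t
      · intro u hu
        rw [← WithOne.coe_mul, WithOne.coe_inj] at hu
        exact hu ▸ mul_inr v t (hy v rfl)
  exact key u u rfl

/-- Derivations of `S * T` are pairs of derivations of `S` and of `T`. -/
theorem FreeProduct.exists_cocycle (ρ : ModuleStructure (FreeProduct S T) M)
    (f : cocycles (ρ.comp (FreeProduct.inl S T)) 1)
    (g : cocycles (ρ.comp (FreeProduct.inr S T)) 1) :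
    ∃ d : cocycles ρ 1, restrictCocycles ρ (FreeProduct.inl S T) d = f ∧
      restrictCocycles ρ (FreeProduct.inr S T) d = g := by
  have hf := (mem_cocycles_one _ _).1 f.2
  have hg := (mem_cocycles_one _ _).1 g.2
  obtain ⟨d, d1, dS, dT⟩ := FreeProduct.exists_of_increments (S := S) (T := T)
    (fun y s => ρ.withOne y (f.1 ![s])) (fun y t => ρ.withOne y (g.1 ![t]))
    (fun y s s' => by
      rw [hf, map_add, map_mul, WithOne.lift_coe]
      rfl)
    (fun y t t' => by
      rw [hg, map_add, map_mul, WithOne.lift_coe]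
      rfl)
  have dS1 : ∀ s, d (FreeProduct.inl S T s : FreeProduct S T) = f.1 ![s] := by
    intro s
    have := dS 1 s
    rwa [one_mul, d1, zero_add, map_one] at this
  have dT1 : ∀ t, d (FreeProduct.inr S T t : FreeProduct S T) = g.1 ![t] := by
    intro t
    have := dT 1 t
    rwa [one_mul, d1, zero_add, map_one] at this
  have hd : ∀ u v : FreeProduct S T, d (u * v : FreeProduct S T) = d u + ρ u (d v) := by
    intro u v
    induction v using FreeProduct.induction with
    | inl s => rw [WithOne.coe_mul, dS, dS1, WithOne.lift_coe]
    | inr t => rw [WithOne.coe_mul, dT, dT1, WithOne.lift_coe]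
    | mul_inl v s hv =>
      rw [← mul_assoc, WithOne.coe_mul, dS, hv, WithOne.coe_mul v, dS, map_add, ← add_assoc,
        WithOne.lift_coe, WithOne.lift_coe, map_mul]
      rfl
    | mul_inr v t hv =>
      rw [← mul_assoc, WithOne.coe_mul, dT, hv, WithOne.coe_mul v, dT, map_add, ← add_assoc,
        WithOne.lift_coe, WithOne.lift_coe, map_mul]
      rfl
  refine ⟨⟨fun x => d (x 0 : FreeProduct S T), (mem_cocycles_one _ _).2 hd⟩,
    Subtype.ext (funext fun x => ?_), Subtype.ext (funext fun x => ?_)⟩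
  · rw [fin_one_eq x, restrictCocycles_apply]
    exact dS1 _
  · rw [fin_one_eq x, restrictCocycles_apply]
    exact dT1 _

/-- Every element is the sum of an `S`-invariant and a `T`-invariant one. -/
def InvariantsSpan (ρ : ModuleStructure (FreeProduct S T) M) : Prop :=
  ∀ m : M, ∃ p q : M, m = p + q ∧ (∀ s, ρ (FreeProduct.inl S T s) p = p) ∧
    ∀ t, ρ (FreeProduct.inr S T t) q = q

/-- Let `d` on `U¹` vanish at 1, stay constant along `S` and have the increments of `h` along `T`.
Then `d` is `S`-invariant and `h - d` is `T`-invariant: the correction terms vanish because `d` is 0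
on `S` and `h - d` is 0 on `T`. -/
theorem invariantsSpan_shiftModule (ρ : ModuleStructure (FreeProduct S T) M) :
    InvariantsSpan (shiftModule ρ) := by
  intro h
  obtain ⟨d, d1, dS, dT⟩ := FreeProduct.exists_of_increments (S := S) (T := T)
    (fun _ _ => (0 : M))
    (fun y t => evalOne (y * ((FreeProduct.inr S T t : FreeProduct S T) :
      WithOne (FreeProduct S T))) h - evalOne y h)
    (fun y s s' => (add_zero _).symm)
    (fun y t t' => by
      rw [map_mul, WithOne.coe_mul, mul_assoc]
      abel)
  have dS1 : ∀ s, d (FreeProduct.inl S T s : FreeProduct S T) = 0 := by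
    intro s
    have := dS 1 s
    rwa [one_mul, d1, zero_add] at this
  have dT1 : ∀ t, d (FreeProduct.inr S T t : FreeProduct S T) = h (FreeProduct.inr S T t) := by
    intro t
    have := dT 1 t
    rwa [one_mul, d1, zero_add, evalOne_one, sub_zero, evalOne_coe] at this
  refine ⟨fun u => d u, fun u => h u - d u, ?_, fun s => ?_, fun t => ?_⟩
  · funext u
    simp
  · funext u
    rw [shiftModule_apply, dS1, WithOne.coe_mul, dS, map_zero, add_zero, sub_zero]
  · funext u
    rw [shiftModule_apply, dT1, WithOne.coe_mul, dT, sub_self, map_zero, ← WithOne.coe_mul,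
      evalOne_coe, evalOne_coe]
    abel

theorem nonempty_cohomology_one (ρ : ModuleStructure (FreeProduct S T) M)
    (hρ : InvariantsSpan ρ) :
    Nonempty (Cohomology ρ 1 ≃+ Cohomology (ρ.comp (FreeProduct.inl S T)) 1 ×
      Cohomology (ρ.comp (FreeProduct.inr S T)) 1) := by
  refine nonempty_quotient_addEquiv _
    (((QuotientAddGroup.mk' _).comp (restrictCocycles ρ (FreeProduct.inl S T))).prod
      ((QuotientAddGroup.mk' _).comp (restrictCocycles ρ (FreeProduct.inr S T)))) ?_ ?_
  · intro f
    have hf := (mem_cocycles_one _ _).1 f.2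
    refine (Prod.ext_iff.trans (and_congr (QuotientAddGroup.eq_zero_iff _)
      (QuotientAddGroup.eq_zero_iff _))).trans ?_
    rw [AddSubgroup.mem_addSubgroupOf, AddSubgroup.mem_addSubgroupOf,
      AddSubgroup.mem_addSubgroupOf, mem_coboundaries_one, mem_coboundaries_one,
      mem_coboundaries_one]
    constructor
    · rintro ⟨⟨a, ha⟩, ⟨b, hb⟩⟩
      -- The elements `a` and `b` give the restrictions to `S` and `T`; changing them by invariants
      -- yields the common element `a - p = b + q`.
      obtain ⟨p, q, hpq, hp, hq⟩ := hρ (a - b)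
      have hab : a - p = b + q := by
        rw [sub_eq_iff_eq_add, add_assoc, add_comm q, ← hpq]
        abel
      have hS : ∀ s, f.1 ![FreeProduct.inl S T s] =
          ρ (FreeProduct.inl S T s) (a - p) - (a - p) := by
        intro s
        rw [map_sub, hp]
        refine (ha s).trans ?_
        rw [MulHom.comp_apply]
        abel
      have hT : ∀ t, f.1 ![FreeProduct.inr S T t] =
          ρ (FreeProduct.inr S T t) (a - p) - (a - p) := by
        intro t
        rw [hab, map_add, hq]
        refine (hb t).trans ?_
        rw [MulHom.comp_apply]
        abel
      refine ⟨a - p, fun u => ?_⟩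
      generalize a - p = m at hS hT ⊢
      induction u using FreeProduct.induction with
      | inl s => exact hS s
      | inr t => exact hT t
      | mul_inl u s hu =>
        rw [hf, hu, hS, map_mul, map_sub, AddMonoid.End.coe_mul, Function.comp_apply]
        abel
      | mul_inr u t hu =>
        rw [hf, hu, hT, map_mul, map_sub, AddMonoid.End.coe_mul, Function.comp_apply]
        abel
    · rintro ⟨m, hm⟩
      exact ⟨⟨m, fun s => hm _⟩, ⟨m, fun t => hm _⟩⟩
  · rintro ⟨a, b⟩
    obtain ⟨f, rfl⟩ := QuotientAddGroup.mk_surjective a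
    obtain ⟨g, rfl⟩ := QuotientAddGroup.mk_surjective b
    obtain ⟨d, rfl, rfl⟩ := FreeProduct.exists_cocycle ρ f g
    exact ⟨d, rfl⟩

/-- The decomposition of cohomology passes from the shifted module to the next degree. -/
theorem nonempty_cohomology_succ (ρ : ModuleStructure (FreeProduct S T) M) (n : ℕ)
    (h : Nonempty (Cohomology (shiftModule ρ) (n + 1) ≃+
      Cohomology ((shiftModule ρ).comp (FreeProduct.inl S T)) (n + 1) ×
        Cohomology ((shiftModule ρ).comp (FreeProduct.inr S T)) (n + 1))) :
    Nonempty (Cohomology ρ (n + 2) ≃+ Cohomology (ρ.comp (FreeProduct.inl S T)) (n + 2) ×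
      Cohomology (ρ.comp (FreeProduct.inr S T)) (n + 2)) := by
  obtain ⟨e⟩ := h
  obtain ⟨DS⟩ := FreeProduct.nonempty_rightFree_inl (S := S) (T := T)
  obtain ⟨DT⟩ := FreeProduct.nonempty_rightFree_inr (S := S) (T := T)
  -- The same shift over `S * T` itself, viewed as free over itself.
  obtain ⟨e₀⟩ := (RightFree.id (FreeProduct S T)).nonempty_cohomology_shift ρ n
  obtain ⟨eS⟩ := DS.nonempty_cohomology_shift ρ n
  obtain ⟨eT⟩ := DT.nonempty_cohomology_shift ρ n
  exact ⟨e₀.symm.trans (e.trans (eS.prodCongr eT))⟩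

end FirstCohomology

/-- The induction replaces `M` by maps from `S * T` to `M`; the universe `max u v w` is closed under
this step. -/
theorem nonempty_cohomology_of_invariantsSpan.{u, v, w} {S : Type u} {T : Type v}
    [Semigroup S] [Semigroup T] (n : ℕ) :
    ∀ {M : Type (max u v w)} [AddCommGroup M] (ρ : ModuleStructure (FreeProduct S T) M),
      InvariantsSpan ρ →
      Nonempty (Cohomology ρ (n + 1) ≃+ Cohomology (ρ.comp (FreeProduct.inl S T)) (n + 1) ×
        Cohomology (ρ.comp (FreeProduct.inr S T)) (n + 1)) := by
  induction n with
  | zero => exact fun ρ hρ => nonempty_cohomology_one ρ hρ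
  | succ n ih =>
    exact fun ρ _ => nonempty_cohomology_succ ρ n (ih _ (invariantsSpan_shiftModule ρ))

end EMCohomology

theorem theorem6 {S T A : Type*} [Semigroup S] [Semigroup T] [AddCommGroup A]
    (ρ : EMCohomology.ModuleStructure (EMCohomology.FreeProduct S T) A)
    (n : ℕ) (hn : 2 ≤ n) :
    Nonempty
      (EMCohomology.Cohomology ρ n ≃+
        EMCohomology.Cohomology (ρ.comp (EMCohomology.FreeProduct.inl S T)) n ×
          EMCohomology.Cohomology (ρ.comp (EMCohomology.FreeProduct.inr S T)) n) := by
  obtain ⟨m, rfl⟩ := Nat.exists_eq_add_of_le' hn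
  -- `A` itself need not be spanned by invariants, so one shift is made before the induction starts.
  exact EMCohomology.nonempty_cohomology_succ ρ m
    (EMCohomology.nonempty_cohomology_of_invariantsSpan m _
      (EMCohomology.invariantsSpan_shiftModule ρ))
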